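/- Assume the Generalized Riemann Hypothesis: for every Dirichlet character $\chi$ (to any modulus), every zero of $L(s,\chi)$ in the strip $0<\Re s<1$ has real part $\frac12$. For a positive integer $q$ and reduced residues $a,b$ modulo $q$, define $$M^*(q;a,b)=\sum_{\substack{\chi \bmod q\\ \chi\neq\chi_0}}|\chi(a)-\chi(b)|^2\,\frac{L'(1,\chi^*)}{L(1,\chi^*)},$$ where $\chi$ runs over the nonprincipal Dirichlet characters modulo $q$ and $\chi^*$ is the primitive character inducing $\chi$. For a prime $p\mid q$ with $p^\nu\,\|\,q$ and a reduced residue $r$ modulo $q$, let $$e(q;p,r)=\min\{e\ge1 : p^e\equiv r^{-1}\ (\mathrm{mod}\ q/p^\nu)\},\qquad h(q;p,r)=\frac1{\phi(p^\nu)}\,\frac{\log p}{p^{e(q;p,r)}},$$ with the convention $e(q;p,r)=\infty$ and $h(q;p,r)=0$ if there is no such $e$, and let $$H(q;a,b)=\sum_{p\mid q}\bigl(h(q;p,ab^{-1})+h(q;p,ba^{-1})\bigr),$$ the sum being over the primes dividing $q$. Then there is an absolute constant $C$ such that for every positive integer $q$ and every pair $a,b$ of distinct reduced residues modulo $q$,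 if $r_1$ and $r_2$ denote the least positive residues of $ab^{-1}$ and $ba^{-1}$ modulo $q$, then $$\left|M^*(q;a,b)-\phi(q)\left(\frac{\Lambda(r_1)}{r_1}+\frac{\Lambda(r_2)}{r_2}+H(q;a,b)\right)\right|\le C\,\phi(q)\,\frac{(\log q)^2}{q},$$ where $\phi$ is Euler's totient function and $\Lambda$ is the von Mangoldt function. -/

import Mathlib

noncomputable section

/-- The Generalized Riemann Hypothesis: for every modulus `N ≥ 1` and every Dirichlet character
`χ` modulo `N`, every nontrivial zero of `L(s, χ)` (that is, every zero in the open critical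
strip `0 < Re s < 1`) has real part `1 / 2`. -/
def GRH : Prop :=
  ∀ (N : ℕ) [NeZero N] (χ : DirichletCharacter ℂ N) (s : ℂ),
    0 < s.re → s.re < 1 → χ.LFunction s = 0 → s.re = 1 / 2

/-- The logarithmic derivative `L'(1, χ*) / L(1, χ*)`, where `χ*` is the primitive character
modulo the conductor of `χ` that induces `χ`. -/
def logDerivLStarOne {q : ℕ} [NeZero q] (χ : DirichletCharacter ℂ q) : ℂ :=
  haveI : NeZero χ.conductor := ⟨χ.conductor_ne_zero⟩
  deriv χ.primitiveCharacter.LFunction 1 / χ.primitiveCharacter.LFunction 1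

open Classical in
/-- `M*(q; a, b) = ∑_{χ mod q, χ ≠ χ₀} |χ(a) - χ(b)|² L'(1, χ*) / L(1, χ*)`. -/
def Mstar (q : ℕ) [NeZero q] (a b : (ZMod q)ˣ) : ℂ :=
  ∑ χ : DirichletCharacter ℂ q with χ ≠ 1,
    ((‖χ (a : ZMod q) - χ (b : ZMod q)‖ ^ 2 : ℝ) : ℂ) * logDerivLStarOne χ

/-- The least positive integer in the residue class `x` modulo `q`. -/
def leastPosResidue {q : ℕ} (x : ZMod q) : ℕ :=
  sInf {r : ℕ | 0 < r ∧ (r : ZMod q) = x}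

/-- `e(q; p, r) = min {e ≥ 1 : p ^ e ≡ r⁻¹ mod q / p ^ ν}` with `p ^ ν ∥ q`,
equal to `⊤` if there is no such exponent. -/
def eExp (q p : ℕ) (r : (ZMod q)ˣ) : ℕ∞ :=
  sInf {x : ℕ∞ | ∃ e : ℕ, x = (e : ℕ∞) ∧ 1 ≤ e ∧
    p ^ e ≡ ((r⁻¹ : (ZMod q)ˣ) : ZMod q).val [MOD q / p ^ q.factorization p]}

/-- `h(q; p, r) = (1 / φ(p ^ ν)) (log p / p ^ e(q; p, r))` with `p ^ ν ∥ q`,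
equal to `0` if `e(q; p, r) = ∞`. -/
def hTerm (q p : ℕ) (r : (ZMod q)ˣ) : ℝ :=
  if eExp q p r = ⊤ then 0
  else 1 / (Nat.totient (p ^ q.factorization p) : ℝ) *
    (Real.log p / (p : ℝ) ^ (eExp q p r).toNat)

/-- `H(q; a, b) = ∑_{p ∣ q} (h(q; p, a b⁻¹) + h(q; p, b a⁻¹))`. -/
def HSum (q : ℕ) (a b : (ZMod q)ˣ) : ℝ :=
  ∑ p ∈ q.primeFactors, (hTerm q p (a * b⁻¹) + hTerm q p (b * a⁻¹))

end

/-!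
Under GRH, `L(s, χ*)` has no zero in the disc `|s - 2| < 3/2`, so by the Borel–Carathéodory
inequality `L'/L(s, χ*)` is `O(log q)` for `|s - 2| ≤ 5/4`. Its Taylor expansion about `s = 2` may
therefore be evaluated at `s = 1`: stopping after `K` terms costs `O((4/5)^K log q)`, which is
`O((log q)² / q)` for `K` about `5 log q`. As the Taylor coefficients at `2` are Dirichlet series,
the truncated expansion is `-∑ χ*(n) Λ(n)/n · P(X < K)` with `X` Poisson of parameter `log n`.

Orthogonality of the characters modulo `q` reduces the weighted sum over `χ` of these absolutely
convergent series to `n ≡ u mod q` and, for each prime `p ∣ q` with `p^ν ∥ q`, to the powers of `p`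
congruent to `u` modulo `q / p^ν`, for `u ∈ {1, a b⁻¹, b a⁻¹}`. In each of these families the
smallest element gives the main term, and all the others together contribute `O((log q)² / q)`.
-/

section PoissonWeight

open Real Finset

theorem exp_sub_sum_range_le {ρ t : ℝ} (hρ : 1 ≤ ρ) (ht : 0 ≤ t) (K : ℕ) :
    exp t - ∑ k ∈ range K, t ^ k / (k.factorial : ℝ) ≤ (ρ ^ K)⁻¹ * exp (ρ * t) := by
  have exp_eq (y : ℝ) : exp y = ∑' k : ℕ, y ^ k / (k.factorial : ℝ) := by
    rw [exp_eq_exp_ℝ, NormedSpace.exp_eq_tsum_div]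
  have hs (y : ℝ) : Summable fun k : ℕ => (y ^ (k + K) / ((k + K).factorial : ℝ)) :=
    (summable_nat_add_iff K).2 (summable_pow_div_factorial y)
  have tail_eq (y : ℝ) : exp y - ∑ k ∈ range K, y ^ k / (k.factorial : ℝ)
      = ∑' k : ℕ, y ^ (k + K) / ((k + K).factorial : ℝ) := by
    rw [exp_eq, ← (summable_pow_div_factorial y).sum_add_tsum_nat_add K, add_sub_cancel_left]
  have tail_le : ∑' k : ℕ, (ρ * t) ^ (k + K) / ((k + K).factorial : ℝ) ≤ exp (ρ * t) := by
    rw [← tail_eq, sub_le_self_iff]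
    positivity
  rw [tail_eq, le_inv_mul_iff₀ (by positivity), ← tsum_mul_left]
  refine (Summable.tsum_le_tsum (fun k => ?_) ((hs t).mul_left _) (hs (ρ * t))).trans tail_le
  rw [mul_pow, mul_div_assoc]
  gcongr
  exact Nat.le_add_left K k

theorem pow_mul_sum_range_le_exp {ρ t : ℝ} (hρ₀ : 0 ≤ ρ) (hρ₁ : ρ ≤ 1) (ht : 0 ≤ t) (K : ℕ) :
    ρ ^ K * ∑ k ∈ range (K + 1), t ^ k / (k.factorial : ℝ) ≤ exp (ρ * t) := by
  refine le_trans ?_ (sum_le_exp_of_nonneg (mul_nonneg hρ₀ ht) (K + 1))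
  rw [mul_sum]
  refine sum_le_sum fun k hk => ?_
  rw [mul_pow, ← mul_div_assoc]
  have := pow_le_pow_of_le_one hρ₀ hρ₁ (Nat.lt_succ_iff.1 (mem_range.1 hk))
  gcongr

theorem exp_neg_one_le_one_sub_inv_pow (K : ℕ) :
    exp (-1) ≤ (1 - ((K + 1 : ℕ) : ℝ)⁻¹) ^ K := by
  rcases K.eq_zero_or_pos with rfl | hK
  · simp
  have : (0 : ℝ) < K := Nat.cast_pos.2 hK
  have hρ : 1 - ((K + 1 : ℕ) : ℝ)⁻¹ = K / (K + 1) := by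
    push_cast
    field_simp
    ring
  rw [hρ, ← log_le_log_iff (exp_pos _) (by positivity), log_exp, log_pow]
  have := one_sub_inv_le_log_of_pos (show (0 : ℝ) < K / (K + 1) by positivity)
  calc (-1 : ℝ) = K * (1 - (K / (K + 1) : ℝ)⁻¹) := by field_simp; ring
    _ ≤ K * log (K / (K + 1)) := by gcongr

/-- The probability that a Poisson variable of parameter `log x` is less than `K`. It is the smooth
cutoff which truncated Taylor expansion at `s = 2` produces in a Dirichlet series at `s = 1`. -/
noncomputable def poissonWeight (K : ℕ) (x : ℝ) : ℝ :=
  x⁻¹ * ∑ k ∈ range K, log x ^ k / (k.factorial : ℝ)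

variable {x : ℝ} (K : ℕ)

theorem poissonWeight_nonneg (hx : 1 ≤ x) : 0 ≤ poissonWeight K x := by
  have := log_nonneg hx
  unfold poissonWeight
  positivity

theorem poissonWeight_le_one (hx : 1 ≤ x) : poissonWeight K x ≤ 1 := by
  have hx₀ : 0 < x := by linarith
  rw [poissonWeight, inv_mul_le_iff₀ hx₀, mul_one]
  simpa only [exp_log hx₀] using sum_le_exp_of_nonneg (log_nonneg hx) K

theorem one_sub_poissonWeight_le (hx : 1 ≤ x) : 1 - poissonWeight K x ≤ (2 ^ K)⁻¹ * x := by
  have hx₀ : 0 < x := by linarith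
  have h := exp_sub_sum_range_le one_le_two (log_nonneg hx) K
  rw [two_mul, exp_add, exp_log hx₀] at h
  refine le_of_mul_le_mul_left ?_ hx₀
  rw [poissonWeight, mul_sub, mul_one, mul_inv_cancel_left₀ hx₀.ne']
  linarith

theorem poissonWeight_le_rpow (hx : 1 ≤ x) : poissonWeight K x ≤ 3 * x ^ (-(K : ℝ)⁻¹) := by
  have hx₀ : 0 < x := by linarith
  rcases K with _ | K
  · simp [poissonWeight]
  set ρ : ℝ := 1 - ((K + 1 : ℕ) : ℝ)⁻¹ with hρ
  have hρ₀ : 0 ≤ ρ := sub_nonneg.2 (Nat.cast_inv_le_one _)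
  have hρ₁ : ρ ≤ 1 := sub_le_self _ (by positivity)
  set S : ℝ := ∑ k ∈ range (K + 1), log x ^ k / (k.factorial : ℝ)
  have hS₀ : 0 ≤ S := by
    have := log_nonneg hx
    positivity
  have hSρ : exp (-1) * S ≤ x ^ ρ := by
    rw [rpow_def_of_pos hx₀, mul_comm (log x)]
    refine le_trans ?_ (pow_mul_sum_range_le_exp hρ₀ hρ₁ (log_nonneg hx) K)
    gcongr
    exact exp_neg_one_le_one_sub_inv_pow K
  have hS₃ : S ≤ 3 * x ^ ρ := by
    rw [exp_neg, inv_mul_le_iff₀ (exp_pos 1)] at hSρ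
    exact hSρ.trans (by gcongr; exact exp_one_lt_three.le)
  rw [poissonWeight, inv_mul_le_iff₀ hx₀]
  refine hS₃.trans_eq ?_
  rw [hρ, sub_eq_add_neg, rpow_add hx₀, rpow_one]
  ring

end PoissonWeight

section SmoothedMangoldt

open ArithmeticFunction Real

/-- The weight `Λ(n) / n`, smoothly cut off by `poissonWeight K`: the summand that `n` contributes
when the Taylor expansion of `-ζ'/ζ` about `2` is cut after `K` terms and evaluated at `1`. -/
noncomputable def smoothMangoldt (K n : ℕ) : ℝ :=
  vonMangoldt n / n * poissonWeight K n

variable (K : ℕ) {n : ℕ}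

theorem smoothMangoldt_nonneg (n : ℕ) : 0 ≤ smoothMangoldt K n := by
  rcases n.eq_zero_or_pos with rfl | hn
  · simp [smoothMangoldt]
  · have := poissonWeight_nonneg K (Nat.one_le_cast.2 hn)
    have := vonMangoldt_nonneg (n := n)
    unfold smoothMangoldt
    positivity

theorem smoothMangoldt_le (n : ℕ) : smoothMangoldt K n ≤ vonMangoldt n / n := by
  rcases n.eq_zero_or_pos with rfl | hn
  · simp [smoothMangoldt]
  · exact mul_le_of_le_one_right (div_nonneg vonMangoldt_nonneg n.cast_nonneg)
      (poissonWeight_le_one K (Nat.one_le_cast.2 hn))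

theorem vonMangoldt_div_sub_smoothMangoldt_le (n : ℕ) :
    vonMangoldt n / n - smoothMangoldt K n ≤ (2 ^ K)⁻¹ * vonMangoldt n := by
  rcases n.eq_zero_or_pos with rfl | hn
  · simp [smoothMangoldt]
  have hn₀ : (n : ℝ) ≠ 0 := Nat.cast_ne_zero.2 hn.ne'
  calc vonMangoldt n / n - smoothMangoldt K n
      = vonMangoldt n / n * (1 - poissonWeight K n) := by rw [smoothMangoldt]; ring
    _ ≤ vonMangoldt n / n * ((2 ^ K)⁻¹ * n) := by
      have := vonMangoldt_nonneg (n := n)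
      gcongr
      exact one_sub_poissonWeight_le K (Nat.one_le_cast.2 hn)
    _ = (2 ^ K)⁻¹ * vonMangoldt n := by field_simp

theorem smoothMangoldt_le_rpow (hn : 1 ≤ n) :
    smoothMangoldt K n ≤ 6 * K * (n : ℝ) ^ (-(1 + (2 * K : ℝ)⁻¹)) := by
  rcases K.eq_zero_or_pos with rfl | hK
  · simp [smoothMangoldt, poissonWeight]
  have : (0 : ℝ) < K := Nat.cast_pos.2 hK
  have hn₁ : (1 : ℝ) ≤ n := Nat.one_le_cast.2 hn
  have hn₀ : (0 : ℝ) < n := by linarith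
  have hlog : vonMangoldt n ≤ 2 * K * (n : ℝ) ^ (2 * K : ℝ)⁻¹ := by
    refine vonMangoldt_le_log.trans ?_
    have := log_le_rpow_div hn₀.le (inv_pos.2 (by positivity : (0 : ℝ) < 2 * K))
    rwa [div_inv_eq_mul, mul_comm] at this
  calc smoothMangoldt K n
      ≤ 2 * K * (n : ℝ) ^ (2 * K : ℝ)⁻¹ / n * (3 * (n : ℝ) ^ (-(K : ℝ)⁻¹)) := by
        rw [smoothMangoldt]
        gcongr
        · exact poissonWeight_nonneg K hn₁
        · exact poissonWeight_le_rpow K hn₁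
    _ = 6 * K * ((n : ℝ) ^ (2 * K : ℝ)⁻¹ * (n : ℝ) ^ (-1 : ℝ) * (n : ℝ) ^ (-(K : ℝ)⁻¹)) := by
        rw [rpow_neg_one]
        ring
    _ = 6 * K * (n : ℝ) ^ (-(1 + (2 * K : ℝ)⁻¹)) := by
        rw [← rpow_add hn₀, ← rpow_add hn₀]
        congr 2
        field_simp
        ring

theorem summable_smoothMangoldt : Summable (smoothMangoldt K) := by
  rcases K.eq_zero_or_pos with rfl | hK
  · exact summable_zero.congr fun n => by simp [smoothMangoldt, poissonWeight]
  have hε : 1 < 1 + (2 * K : ℝ)⁻¹ := by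
    have : (0 : ℝ) < K := Nat.cast_pos.2 hK
    simpa using this
  refine .of_nonneg_of_le (smoothMangoldt_nonneg K) (fun n => ?_)
    ((summable_nat_rpow.2 (neg_lt_neg hε)).mul_left (6 * K : ℝ))
  rcases n.eq_zero_or_pos with rfl | hn
  · simp only [smoothMangoldt, CharP.cast_eq_zero, div_zero, zero_mul]
    positivity
  · exact smoothMangoldt_le_rpow K hn

end SmoothedMangoldt

section LFunctionBounds

open Complex Filter Finset MeasureTheory Set

/-- The summatory function `t ↦ ∑_{1 ≤ n ≤ t} f(n)`, as a function of a real variable. -/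
noncomputable def summatory (f : ℕ → ℂ) (t : ℝ) : ℂ :=
  ∑ k ∈ Finset.Icc 1 ⌊t⌋₊, f k

theorem summatory_of_lt_one (f : ℕ → ℂ) {t : ℝ} (ht : t < 1) : summatory f t = 0 := by
  simp [summatory, Nat.floor_eq_zero.2 ht]

theorem mellin_summatory_eq_setIntegral_Ioi_one (f : ℕ → ℂ) (s : ℂ) :
    mellin (summatory f) s = ∫ t in Ioi (1 : ℝ), (t : ℂ) ^ (s - 1) • summatory f t := by
  rw [mellin, ← integral_Ici_eq_integral_Ioi (x := (1 : ℝ))]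
  refine setIntegral_eq_of_subset_of_forall_sdiff_eq_zero measurableSet_Ioi
    (Ici_subset_Ioi.2 one_pos) fun t ht => ?_
  rw [summatory_of_lt_one f (not_le.1 ht.2), smul_zero]

theorem locallyIntegrable_summatory {f : ℕ → ℂ} {B : ℝ}
    (hf : ∀ n, ‖∑ k ∈ Finset.Icc 1 n, f k‖ ≤ B) : LocallyIntegrable (summatory f) := by
  have hmeas : Measurable (summatory f) :=
    (measurable_from_nat (f := fun n => ∑ k ∈ Finset.Icc 1 n, f k)).comp Nat.measurable_floor
  exact (locallyIntegrable_const B).mono hmeas.aestronglyMeasurable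
    (ae_of_all _ fun t => (hf _).trans (le_abs_self B))

theorem LSeries_eq_mul_mellin_summatory {f : ℕ → ℂ} {B : ℝ}
    (hf : ∀ n, ‖∑ k ∈ Finset.Icc 1 n, f k‖ ≤ B) {s : ℂ} (hs : 0 < s.re)
    (hfs : LSeriesSummable f s) : LSeries f s = s * mellin (summatory f) (-s) := by
  have hO : (fun n => ∑ k ∈ Finset.Icc 1 n, f k) =O[atTop] fun n : ℕ => (n : ℝ) ^ (0 : ℝ) :=
    Asymptotics.IsBigO.of_bound B (.of_forall fun n => by simpa using hf n)
  rw [LSeries_eq_mul_integral f le_rfl hs hfs hO, mellin_summatory_eq_setIntegral_Ioi_one]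
  congr 1
  refine integral_congr_ae (ae_of_all _ fun t => ?_)
  simp only [summatory, smul_eq_mul]
  rw [mul_comm, neg_add', sub_eq_add_neg]

theorem differentiableAt_mellin_summatory {f : ℕ → ℂ} {B : ℝ}
    (hf : ∀ n, ‖∑ k ∈ Finset.Icc 1 n, f k‖ ≤ B) {s : ℂ} (hs : s.re < 0) :
    DifferentiableAt ℂ (mellin (summatory f)) s := by
  refine mellin_differentiableAt_of_isBigO_rpow (a := 0) (b := s.re - 1)
    ((locallyIntegrable_summatory hf).locallyIntegrableOn _) ?_ hs ?_ (by linarith)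
  · exact Asymptotics.IsBigO.of_bound B (.of_forall fun t => by simpa [summatory] using hf ⌊t⌋₊)
  · refine (Asymptotics.isBigO_zero _ _).congr' ?_ .rfl
    filter_upwards [nhdsWithin_le_nhds (Iio_mem_nhds one_pos)] with t ht
    exact (summatory_of_lt_one f ht).symm

theorem norm_mellin_summatory_le {f : ℕ → ℂ} {B : ℝ}
    (hf : ∀ n, ‖∑ k ∈ Finset.Icc 1 n, f k‖ ≤ B) {s : ℂ} (hs : s.re < 0) :
    ‖mellin (summatory f) s‖ ≤ B / -s.re := by
  have hint : IntegrableOn (fun t : ℝ => t ^ (s.re - 1) * B) (Ioi 1) :=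
    (integrableOn_Ioi_rpow_of_lt (by linarith) one_pos).mul_const B
  rw [mellin_summatory_eq_setIntegral_Ioi_one]
  refine (norm_integral_le_of_norm_le hint ?_).trans_eq ?_
  · filter_upwards [ae_restrict_mem measurableSet_Ioi] with t ht
    have ht₀ : 0 < t := one_pos.trans (mem_Ioi.1 ht)
    rw [norm_smul, norm_cpow_eq_rpow_re_of_pos ht₀, sub_re, one_re]
    gcongr
    exact hf _
  · rw [integral_mul_const, integral_Ioi_rpow_of_lt (by linarith) one_pos]
    simp only [Real.one_rpow, sub_add_cancel]
    ring

theorem sum_range_dirichletCharacter_add_eq_zero {N : ℕ} [NeZero N] {χ : DirichletCharacter ℂ N}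
    (hχ : χ ≠ 1) (c : ZMod N) : ∑ i ∈ range N, χ (c + i) = 0 := by
  rw [← MulChar.sum_eq_zero_of_ne_one hχ]
  refine sum_nbij' (fun i => c + i) (fun x => (x - c).val) (fun _ _ => Finset.mem_univ _)
    (fun x _ => Finset.mem_range.2 (ZMod.val_lt _)) (fun i hi => ?_) (fun x _ => ?_) fun _ _ => rfl
  · rw [add_sub_cancel_left, ZMod.val_natCast_of_lt (Finset.mem_range.1 hi)]
  · rw [ZMod.natCast_rightInverse, add_sub_cancel]

theorem norm_sum_range_dirichletCharacter_add_le {N : ℕ} [NeZero N] {χ : DirichletCharacter ℂ N}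
    (hχ : χ ≠ 1) (c : ZMod N) (n : ℕ) : ‖∑ i ∈ range n, χ (c + i)‖ ≤ N := by
  induction n using Nat.strong_induction_on generalizing c with
  | _ n ih =>
    rcases lt_or_ge n N with hn | hn
    · calc ‖∑ i ∈ range n, χ (c + i)‖ ≤ ∑ i ∈ range n, ‖χ (c + i)‖ := norm_sum_le _ _
        _ ≤ ∑ _i ∈ range n, (1 : ℝ) := sum_le_sum fun _ _ => χ.norm_le_one _
        _ ≤ N := by simpa using hn.le
    · obtain ⟨m, rfl⟩ := Nat.exists_eq_add_of_le hn
      rw [sum_range_add, sum_range_dirichletCharacter_add_eq_zero hχ, zero_add]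
      simp only [Nat.cast_add, CharP.cast_eq_zero, zero_add]
      exact ih m (Nat.lt_add_of_pos_left (NeZero.pos N)) c

theorem norm_sum_Icc_dirichletCharacter_le {N : ℕ} [NeZero N] {χ : DirichletCharacter ℂ N}
    (hχ : χ ≠ 1) (n : ℕ) : ‖∑ k ∈ Finset.Icc 1 n, χ k‖ ≤ N := by
  rw [← Finset.Ico_add_one_right_eq_Icc, sum_Ico_eq_sum_range]
  simpa using norm_sum_range_dirichletCharacter_add_le hχ 1 n

theorem LFunction_eq_mul_mellin_summatory {N : ℕ} [NeZero N] {χ : DirichletCharacter ℂ N}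
    (hχ : χ ≠ 1) {s : ℂ} (hs : 0 < s.re) :
    χ.LFunction s = s * mellin (summatory fun n => χ n) (-s) := by
  have hopen : IsOpen {z : ℂ | 0 < z.re} := isOpen_lt continuous_const continuous_re
  have hdiff : DifferentiableOn ℂ (fun z => z * mellin (summatory fun n => χ n) (-z))
      {z : ℂ | 0 < z.re} := fun z hz => by
    have hmellin := differentiableAt_mellin_summatory (norm_sum_Icc_dirichletCharacter_le hχ)
      (s := -z) (by simpa using hz)
    exact (differentiableAt_id.mul
      (hmellin.comp z differentiableAt_id.neg)).differentiableWithinAt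
  refine ((DirichletCharacter.differentiable_LFunction hχ).differentiableOn.analyticOnNhd
    hopen).eqOn_of_preconnected_of_eventuallyEq (hdiff.analyticOnNhd hopen)
    (convex_halfSpace_re_gt 0).isPreconnected (show (2 : ℂ) ∈ _ by simp) ?_ hs
  filter_upwards [(isOpen_lt continuous_const continuous_re).mem_nhds
    (show (1 : ℝ) < (2 : ℂ).re by simp)] with z hz
  rw [χ.LFunction_eq_LSeries hz]
  exact LSeries_eq_mul_mellin_summatory (norm_sum_Icc_dirichletCharacter_le hχ)
    (one_pos.trans hz) (χ.LSeriesSummable_of_one_lt_re hz)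

theorem norm_LFunction_le {N : ℕ} [NeZero N] {χ : DirichletCharacter ℂ N} (hχ : χ ≠ 1) {s : ℂ}
    (hs : 0 < s.re) : ‖χ.LFunction s‖ ≤ ‖s‖ * (N / s.re) := by
  rw [LFunction_eq_mul_mellin_summatory hχ hs, norm_mul]
  gcongr
  simpa using norm_mellin_summatory_le (norm_sum_Icc_dirichletCharacter_le hχ)
    (s := -s) (by simpa using hs)

theorem one_le_norm_LFunction_mul_tsum {N : ℕ} [NeZero N] (χ : DirichletCharacter ℂ N) {s : ℂ}
    (hs : 1 < s.re) : 1 ≤ ‖χ.LFunction s‖ * ∑' n : ℕ, 1 / (n : ℝ) ^ s.re := by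
  set f : ℕ → ℂ := (fun n : ℕ => χ n) * fun n : ℕ => (ArithmeticFunction.moebius n : ℂ) with hf
  have hLf : ‖LSeries f s‖ ≤ ∑' n : ℕ, 1 / (n : ℝ) ^ s.re := by
    refine tsum_of_norm_bounded (Real.summable_one_div_nat_rpow.2 hs).hasSum fun n => ?_
    rw [LSeries.norm_term_eq]
    split_ifs with hn
    · positivity
    gcongr
    rw [hf, Pi.mul_apply, norm_mul, norm_intCast]
    exact mul_le_one₀ (χ.norm_le_one _) (abs_nonneg _)
      (mod_cast ArithmeticFunction.abs_moebius_le_one)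
  calc (1 : ℝ) = ‖χ.LFunction s‖ * ‖LSeries f s‖ := by
        rw [χ.LFunction_eq_LSeries hs, ← norm_mul, DirichletCharacter.LSeries.mul_mu_eq_one χ hs,
          norm_one]
    _ ≤ ‖χ.LFunction s‖ * ∑' n : ℕ, 1 / (n : ℝ) ^ s.re := by gcongr

theorem one_lt_of_dirichletCharacter_ne_one {N : ℕ} [NeZero N] {χ : DirichletCharacter ℂ N}
    (hχ : χ ≠ 1) : 1 < N := by
  refine lt_of_le_of_ne (NeZero.pos N) ?_
  rintro rfl
  exact hχ χ.level_one

theorem norm_LFunction_le_exp_mul_norm_LFunction_two {N : ℕ} [NeZero N]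
    {χ : DirichletCharacter ℂ N} (hχ : χ ≠ 1) {s : ℂ} (hs : s ∈ Metric.ball (2 : ℂ) (3 / 2)) :
    ‖χ.LFunction s‖ ≤ Real.exp (5 * Real.log N) * ‖χ.LFunction 2‖ := by
  have hN : (2 : ℝ) ≤ N := mod_cast one_lt_of_dirichletCharacter_ne_one hχ
  have hdist : ‖s - 2‖ < 3 / 2 := mem_ball_iff_norm.1 hs
  have hnorm : ‖s‖ ≤ 7 / 2 := by
    have := norm_le_norm_add_norm_sub' s 2
    rw [norm_ofNat] at this
    linarith
  have hre : 1 / 2 ≤ s.re := by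
    have := (abs_le.1 ((abs_re_le_norm (s - 2)).trans hdist.le)).1
    rw [sub_re, re_ofNat] at this
    linarith
  have hzeta : ∑' n : ℕ, 1 / (n : ℝ) ^ (2 : ℂ).re ≤ 2 := by
    have := hasSum_zeta_two.tsum_eq
    rw [re_ofNat]
    norm_cast at this ⊢
    rw [this]
    nlinarith [Real.pi_pos, Real.pi_lt_d2]
  have hL : ‖χ.LFunction s‖ ≤ 7 * N :=
    calc ‖χ.LFunction s‖ ≤ ‖s‖ * (N / s.re) := norm_LFunction_le hχ (by linarith)
      _ ≤ 7 / 2 * (N / (1 / 2)) := by gcongr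
      _ = 7 * N := by ring
  have hL₂ : 1 ≤ ‖χ.LFunction 2‖ * 2 :=
    (one_le_norm_LFunction_mul_tsum χ (s := 2) (by simp)).trans (by gcongr)
  calc ‖χ.LFunction s‖ ≤ 7 * N * (‖χ.LFunction 2‖ * 2) :=
        hL.trans (le_mul_of_one_le_right (by positivity) hL₂)
    _ = 14 * N * ‖χ.LFunction 2‖ := by ring
    _ ≤ (N : ℝ) ^ 5 * ‖χ.LFunction 2‖ := by
        gcongr
        have : (2 : ℝ) ^ 4 ≤ N ^ 4 := by gcongr
        nlinarith
    _ = Real.exp (5 * Real.log N) * ‖χ.LFunction 2‖ := by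
        rw [mul_comm 5, Real.exp_mul, Real.exp_log (by linarith)]
        norm_cast

end LFunctionBounds

section HolomorphicBounds

open Complex Metric Set

variable {F : ℂ → ℂ} {c s : ℂ} {R : ℝ}

theorem differentiableOn_logDeriv {U : Set ℂ} (hU : IsOpen U) (hF : DifferentiableOn ℂ F U)
    (hF₀ : ∀ z ∈ U, F z ≠ 0) : DifferentiableOn ℂ (logDeriv F) U :=
  (hF.deriv hU).div hF hF₀

theorem exists_hasDerivAt_logDeriv_eqOn_mul_exp (hR : 0 < R)
    (hF : DifferentiableOn ℂ F (ball c R)) (hF₀ : ∀ z ∈ ball c R, F z ≠ 0) :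
    ∃ G : ℂ → ℂ, G c = 0 ∧ (∀ z ∈ ball c R, HasDerivAt G (logDeriv F z) z) ∧
      EqOn F (fun z => F c * exp (G z)) (ball c R) := by
  obtain ⟨G, hGc, hG⟩ :=
    (differentiableOn_logDeriv isOpen_ball hF hF₀).isExactOn_ball.with_val_at c 0
  have hexp : DifferentiableOn ℂ (fun z => exp (G z)) (ball c R) := fun z hz =>
    (hG z hz).cexp.differentiableAt.differentiableWithinAt
  have hlog : EqOn (logDeriv F) (logDeriv fun z => exp (G z)) (ball c R) := fun z hz => by
    rw [logDeriv_apply (fun z => exp (G z)), (hG z hz).cexp.deriv,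
      mul_div_cancel_left₀ _ (exp_ne_zero _)]
  obtain ⟨w, -, hw⟩ := (logDeriv_eqOn_iff hF hexp isOpen_ball (convex_ball c R).isPreconnected
    (fun _ _ => exp_ne_zero _) hF₀).1 hlog
  have hwc : F c = w := by simpa [hGc] using hw (mem_ball_self hR)
  exact ⟨G, hGc, hG, fun z hz => by simpa [hwc] using hw hz⟩

theorem norm_le_of_re_le_of_mem_closedBall {G : ℂ → ℂ} {M r : ℝ} (hM : 0 < M) (hr : r < R)
    (hG : DifferentiableOn ℂ G (ball c R)) (hGc : G c = 0) (hre : ∀ z ∈ ball c R, (G z).re ≤ M)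
    (hs : s ∈ closedBall c r) : ‖G s‖ ≤ 2 * M * r / (R - r) := by
  have hs' : ‖s - c‖ ≤ r := mem_closedBall_iff_norm.1 hs
  have hmaps : MapsTo (fun z : ℂ => c + z) (ball 0 R) (ball c R) := fun z hz => by simpa using hz
  have h := borelCaratheodory_zero (f := fun z => G (c + z)) (z := s - c) hM
    (hG.comp (by fun_prop) hmaps) (fun z hz => hre _ (hmaps hz))
    ((norm_nonneg _).trans_lt (hs'.trans_lt hr)) (mem_ball_zero_iff.2 (hs'.trans_lt hr))
    (by simpa using hGc)
  rw [add_sub_cancel] at h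
  refine h.trans ?_
  have := sub_pos.2 hr
  have := (norm_nonneg _).trans hs'
  gcongr

theorem norm_logDeriv_le {M r : ℝ} (hM : 0 < M) (hr : r < R)
    (hF : DifferentiableOn ℂ F (ball c R)) (hF₀ : ∀ z ∈ ball c R, F z ≠ 0)
    (hFM : ∀ z ∈ ball c R, ‖F z‖ ≤ Real.exp M * ‖F c‖) (hs : s ∈ closedBall c r) :
    ‖logDeriv F s‖ ≤ 4 * M * (R + r) / (R - r) ^ 2 := by
  have hr₀ : 0 ≤ r := dist_nonneg.trans (mem_closedBall.1 hs)
  have hR : 0 < R := hr₀.trans_lt hr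
  obtain ⟨G, hGc, hG, hFG⟩ := exists_hasDerivAt_logDeriv_eqOn_mul_exp hR hF hF₀
  have hGd : DifferentiableOn ℂ G (ball c R) := fun z hz =>
    (hG z hz).differentiableAt.differentiableWithinAt
  have hre (z) (hz : z ∈ ball c R) : (G z).re ≤ M := by
    have h := hFM z hz
    rw [hFG hz, norm_mul, norm_exp, mul_comm] at h
    exact Real.exp_le_exp.1
      (le_of_mul_le_mul_right h (norm_pos_iff.2 (hF₀ c (mem_ball_self hR))))
  have hsub : closedBall s ((R - r) / 2) ⊆ closedBall c ((R + r) / 2) :=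
    closedBall_subset_closedBall' (by linarith [mem_closedBall.1 hs])
  have hmid : (R + r) / 2 < R := by linarith
  have hGle (w) (hw : w ∈ sphere s ((R - r) / 2)) :
      ‖G w‖ ≤ 2 * M * ((R + r) / 2) / (R - (R + r) / 2) :=
    norm_le_of_re_le_of_mem_closedBall hM hmid hGd hGc hre (hsub (sphere_subset_closedBall hw))
  have hcauchy := norm_deriv_le_of_forall_mem_sphere_norm_le (by linarith)
    ((hGd.mono (hsub.trans (closedBall_subset_ball hmid))).diffContOnCl_ball subset_rfl) hGle
  rw [(hG s (closedBall_subset_ball hr hs)).deriv] at hcauchy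
  refine hcauchy.trans_eq ?_
  have : R - r ≠ 0 := by linarith
  rw [show R - (R + r) / 2 = (R - r) / 2 by ring]
  field_simp
  ring

theorem norm_sub_sum_taylor_le {C r : ℝ} (hF : DiffContOnCl ℂ F (ball c r))
    (hC : ∀ w ∈ sphere c r, ‖F w‖ ≤ C) (hs : s ∈ ball c r) (K : ℕ) :
    ‖F s - ∑ k ∈ Finset.range K, (k.factorial : ℂ)⁻¹ * (s - c) ^ k * iteratedDeriv k F c‖
      ≤ C * (‖s - c‖ / r) ^ K / (1 - ‖s - c‖ / r) := by
  have hr : 0 < r := pos_of_mem_ball hs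
  set ρ : ℝ := ‖s - c‖ / r with hρ
  have hρ₁ : ρ < 1 := (div_lt_one hr).2 (mem_ball_iff_norm.1 hs)
  have hcoef (k : ℕ) : ‖(k.factorial : ℂ)⁻¹ • (s - c) ^ k • iteratedDeriv k F c‖ ≤ C * ρ ^ k := by
    rw [norm_smul, norm_smul, norm_pow, norm_inv, norm_natCast, inv_mul_le_iff₀ (by positivity)]
    calc ‖s - c‖ ^ k * ‖iteratedDeriv k F c‖
        ≤ ‖s - c‖ ^ k * (k.factorial * C / r ^ k) := by
          gcongr
          exact norm_iteratedDeriv_le_of_forall_mem_sphere_norm_le k hr hF hC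
      _ = k.factorial * (C * ρ ^ k) := by
          rw [hρ, div_pow]
          ring
  have hgeom : HasSum (fun k : ℕ => C * ρ ^ (k + K)) (C * ρ ^ K / (1 - ρ)) :=
    ((hasSum_geometric_of_lt_one (by positivity) hρ₁).mul_left (C * ρ ^ K)).congr_fun
      fun k => by ring
  have htail := (hasSum_nat_add_iff' K).2 (hasSum_taylorSeries_on_ball hF.differentiableOn hs)
  have := tsum_of_norm_bounded hgeom fun k => hcoef (k + K)
  rw [htail.tsum_eq] at this
  simpa only [smul_eq_mul, mul_assoc] using this

end HolomorphicBounds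

section TaylorApproximation

open ArithmeticFunction Complex Metric
open scoped LSeries.notation

theorem LFunction_ne_zero_of_mem_ball (hGRH : GRH) {N : ℕ} [NeZero N] {χ : DirichletCharacter ℂ N}
    (hχ : χ ≠ 1) {s : ℂ} (hs : s ∈ ball (2 : ℂ) (3 / 2)) : χ.LFunction s ≠ 0 := fun hs₀ => by
  have hre := (abs_lt.1 ((abs_re_le_norm (s - 2)).trans_lt (mem_ball_iff_norm.1 hs))).1
  rw [sub_re, re_ofNat] at hre
  rcases lt_or_ge s.re 1 with h | h
  · linarith [hGRH N χ s (by linarith) h hs₀]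
  · exact χ.LFunction_ne_zero_of_one_le_re (.inl hχ) h hs₀

theorem norm_logDeriv_LFunction_le {N : ℕ} [NeZero N] {χ : DirichletCharacter ℂ N} (hχ : χ ≠ 1)
    (hχ₀ : ∀ s ∈ ball (2 : ℂ) (3 / 2), χ.LFunction s ≠ 0) {s : ℂ}
    (hs : s ∈ closedBall (2 : ℂ) (5 / 4)) : ‖logDeriv χ.LFunction s‖ ≤ 880 * Real.log N := by
  have hlog : 0 < Real.log N :=
    Real.log_pos (Nat.one_lt_cast.2 (one_lt_of_dirichletCharacter_ne_one hχ))
  refine (norm_logDeriv_le (M := 5 * Real.log N) (by positivity) (by norm_num)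
    (DirichletCharacter.differentiable_LFunction hχ).differentiableOn hχ₀
    (fun z hz => norm_LFunction_le_exp_mul_norm_LFunction_two hχ hz) hs).trans_eq ?_
  ring

theorem summable_mul_smoothMangoldt {N : ℕ} (χ : DirichletCharacter ℂ N) (K : ℕ) :
    Summable fun n : ℕ => χ n * (smoothMangoldt K n : ℂ) :=
  .of_norm_bounded (summable_smoothMangoldt K) fun n => by
    rw [norm_mul, Complex.norm_of_nonneg (smoothMangoldt_nonneg K n)]
    exact mul_le_of_le_one_left (smoothMangoldt_nonneg K n) (χ.norm_le_one _)

theorem iterate_logMul_apply (f : ℕ → ℂ) (k n : ℕ) :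
    (LSeries.logMul^[k] f) n = Complex.log n ^ k * f n := by
  induction k with
  | zero => simp
  | succ k ih =>
    rw [Function.iterate_succ_apply', LSeries.logMul, ih]
    ring

theorem term_logMul_twist_vonMangoldt {N : ℕ} (χ : DirichletCharacter ℂ N) (k n : ℕ) :
    (k.factorial : ℂ)⁻¹ *
        LSeries.term (LSeries.logMul^[k] (↗χ * ↗vonMangoldt)) 2 n
      = χ n * (smoothMangoldt (k + 1) n : ℂ) - χ n * (smoothMangoldt k n : ℂ) := by
  rcases eq_or_ne n 0 with rfl | hn
  · simp [smoothMangoldt]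
  have hn' : (n : ℂ) ≠ 0 := Nat.cast_ne_zero.2 hn
  rw [LSeries.term_of_ne_zero hn, iterate_logMul_apply, ← natCast_log, Pi.mul_apply, cpow_ofNat,
    smoothMangoldt, smoothMangoldt, poissonWeight, poissonWeight, Finset.sum_range_succ]
  push_cast
  field_simp
  ring

theorem iteratedDeriv_logDeriv_LFunction_two {N : ℕ} [NeZero N] (χ : DirichletCharacter ℂ N)
    (k : ℕ) :
    (k.factorial : ℂ)⁻¹ * (1 - 2) ^ k * iteratedDeriv k (logDeriv χ.LFunction) 2
      = ∑' n : ℕ, χ n * (smoothMangoldt k n : ℂ)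
        - ∑' n : ℕ, χ n * (smoothMangoldt (k + 1) n : ℂ) := by
  have hL : logDeriv χ.LFunction =ᶠ[nhds 2]
      -LSeries (↗χ * ↗vonMangoldt) := by
    filter_upwards [(isOpen_lt continuous_const continuous_re).mem_nhds
      (show (1 : ℝ) < (2 : ℂ).re by simp)] with z hz
    rw [Pi.neg_apply, χ.LSeries_twist_vonMangoldt_eq hz, logDeriv_apply, χ.LFunction_eq_LSeries hz,
      χ.deriv_LFunction_eq_deriv_LSeries hz, neg_div, neg_neg]
  have habs : LSeries.abscissaOfAbsConv (↗χ * ↗vonMangoldt) < (2 : ℂ).re :=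
    (LSeries.abscissaOfAbsConv_le_of_forall_lt_LSeriesSummable (x := 1) fun y hy =>
      χ.LSeriesSummable_twist_vonMangoldt (by simpa using hy)).trans_lt
        (EReal.coe_lt_coe_iff.2 (by simp))
  have hsign : ((1 : ℂ) - 2) ^ k * (-1) ^ k = 1 := by
    rw [← mul_pow]
    norm_num
  rw [hL.iteratedDeriv_eq, iteratedDeriv_neg, LSeries_iteratedDeriv k habs,
    ← neg_sub (∑' n : ℕ, χ n * (smoothMangoldt (k + 1) n : ℂ)),
    ← (summable_mul_smoothMangoldt χ (k + 1)).tsum_sub (summable_mul_smoothMangoldt χ k)]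
  simp_rw [← term_logMul_twist_vonMangoldt]
  rw [tsum_mul_left, LSeries]
  linear_combination (-(k.factorial : ℂ)⁻¹ * ∑' n,
    LSeries.term (LSeries.logMul^[k] (↗χ * ↗vonMangoldt)) 2 n) * hsign

theorem norm_logDeriv_LFunction_one_add_tsum_le {N : ℕ} [NeZero N] {χ : DirichletCharacter ℂ N}
    (hχ : χ ≠ 1) (hχ₀ : ∀ s ∈ ball (2 : ℂ) (3 / 2), χ.LFunction s ≠ 0) (K : ℕ) :
    ‖logDeriv χ.LFunction 1 + ∑' n : ℕ, χ n * (smoothMangoldt K n : ℂ)‖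
      ≤ 4400 * Real.log N * (4 / 5) ^ K := by
  have hdiff := differentiableOn_logDeriv isOpen_ball
    (DirichletCharacter.differentiable_LFunction hχ).differentiableOn hχ₀
  have h := norm_sub_sum_taylor_le (s := 1)
    ((hdiff.mono (closedBall_subset_ball (by norm_num : (5 / 4 : ℝ) < 3 / 2))).diffContOnCl_ball
      subset_rfl)
    (fun w hw => norm_logDeriv_LFunction_le hχ hχ₀ (sphere_subset_closedBall hw))
    (by rw [mem_ball_iff_norm]; norm_num) K
  have hzero : ∑' n : ℕ, χ n * (smoothMangoldt 0 n : ℂ) = 0 := by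
    simp [smoothMangoldt, poissonWeight]
  have hdist : ‖(1 - 2 : ℂ)‖ / (5 / 4) = 4 / 5 := by norm_num
  simp_rw [iteratedDeriv_logDeriv_LFunction_two] at h
  rw [Finset.sum_range_sub' (fun k => ∑' n : ℕ, χ n * (smoothMangoldt k n : ℂ)), hzero,
    zero_sub, sub_neg_eq_add, hdist] at h
  exact h.trans_eq (by ring)

end TaylorApproximation

section ArithmeticProgressions

open ArithmeticFunction Real Set

theorem tsum_rpow_neg_one_add_le {ε : ℝ} (hε : 0 < ε) :
    ∑' k : ℕ, ((k + 1 : ℕ) : ℝ) ^ (-(1 + ε)) ≤ 1 + ε⁻¹ := by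
  have hexp : -(1 + ε) < -1 := neg_lt_neg (lt_add_of_pos_right 1 hε)
  have hsum : Summable fun k : ℕ => ((k + 1 : ℕ) : ℝ) ^ (-(1 + ε)) :=
    (summable_nat_add_iff 1).2 (summable_nat_rpow.2 hexp)
  have htail := AntitoneOn.tsum_comp_add_le_integral (f := fun t : ℝ => t ^ (-(1 + ε))) 1
    ((antitoneOn_rpow_Ioi_of_exponent_nonpos (by linarith)).mono
      (Ici_subset_Ioi.2 (by norm_num)))
    (integrableOn_Ioi_rpow_of_lt hexp (by norm_num))
    fun t ht => rpow_nonneg (by simpa using (Nat.cast_nonneg 1).trans ht.le) _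
  rw [integral_Ioi_rpow_of_lt hexp (by norm_num), Nat.cast_one, one_rpow] at htail
  rw [hsum.tsum_eq_zero_add, zero_add, Nat.cast_one, one_rpow]
  refine add_le_add_right (htail.trans_eq ?_) 1
  rw [neg_add, neg_add_cancel_comm, neg_div_neg_eq, one_div]

variable {K : ℕ}

theorem abs_tsum_indicator_smoothMangoldt_sub_le {s : Set ℕ} {n : ℕ} (hn : n ∈ s) :
    |∑' i, s.indicator (smoothMangoldt K) i - vonMangoldt n / n|
      ≤ (2 ^ K)⁻¹ * vonMangoldt n + ∑' i, (s \ {n}).indicator (smoothMangoldt K) i := by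
  have hsplit : ∑' i, s.indicator (smoothMangoldt K) i
      = smoothMangoldt K n + ∑' i, (s \ {n}).indicator (smoothMangoldt K) i := by
    rw [((summable_smoothMangoldt K).indicator s).tsum_eq_add_tsum_ite n,
      indicator_of_mem hn]
    congr 2 with i
    simp only [indicator, mem_sdiff, mem_singleton_iff]
    grind
  have hrest : 0 ≤ ∑' i, (s \ {n}).indicator (smoothMangoldt K) i :=
    tsum_nonneg (indicator_nonneg fun i _ => smoothMangoldt_nonneg K i)
  have := smoothMangoldt_le K n
  have := vonMangoldt_div_sub_smoothMangoldt_le K n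
  rw [hsplit, abs_le]
  constructor <;> linarith

theorem smoothMangoldt_add_mul_le {q : ℕ} (hq : 0 < q) (r k : ℕ) :
    smoothMangoldt K (r + (k + 1) * q)
      ≤ 6 * K / q * ((k + 1 : ℕ) : ℝ) ^ (-(1 + (2 * K : ℝ)⁻¹)) := by
  have hexp : -(1 + (2 * K : ℝ)⁻¹) ≤ -1 := neg_le_neg (le_add_of_nonneg_right (by positivity))
  calc smoothMangoldt K (r + (k + 1) * q)
      ≤ 6 * K * ((r + (k + 1) * q : ℕ) : ℝ) ^ (-(1 + (2 * K : ℝ)⁻¹)) :=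
        smoothMangoldt_le_rpow K (by nlinarith)
    _ ≤ 6 * K * (((k + 1 : ℕ) : ℝ) * q) ^ (-(1 + (2 * K : ℝ)⁻¹)) := by
        refine mul_le_mul_of_nonneg_left (rpow_le_rpow_of_nonpos (by positivity) ?_
          (by linarith)) (by positivity)
        exact_mod_cast Nat.le_add_left _ _
    _ ≤ 6 * K * (((k + 1 : ℕ) : ℝ) ^ (-(1 + (2 * K : ℝ)⁻¹)) * (q : ℝ) ^ (-1 : ℝ)) := by
        rw [mul_rpow (by positivity) (by positivity)]
        have := rpow_le_rpow_of_exponent_le (Nat.one_le_cast.2 hq : (1 : ℝ) ≤ q) hexp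
        gcongr
    _ = 6 * K / q * ((k + 1 : ℕ) : ℝ) ^ (-(1 + (2 * K : ℝ)⁻¹)) := by
        rw [rpow_neg_one]
        ring

theorem modEq_diff_singleton_subset_range {q r : ℕ} (hr : r < q) :
    {n | n ≡ r [MOD q]} \ {r} ⊆ range fun k : ℕ => r + (k + 1) * q := by
  rintro n ⟨hn, hnr⟩
  rw [mem_ofPred_eq, Nat.ModEq, Nat.mod_eq_of_lt hr] at hn
  have hdiv : n / q ≠ 0 := fun h => hnr <| by
    rw [mem_singleton_iff, ← hn, Nat.mod_eq_of_lt ((Nat.div_eq_zero_iff_lt (by lia)).1 h)]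
  obtain ⟨k, hk⟩ := Nat.exists_eq_succ_of_ne_zero hdiv
  exact ⟨k, by simp only [← Nat.succ_eq_add_one, ← hk, ← hn, Nat.mod_add_div']⟩

theorem tsum_indicator_smoothMangoldt_modEq_diff_le {q r : ℕ} (hr : r < q) :
    ∑' n, ({n | n ≡ r [MOD q]} \ {r}).indicator (smoothMangoldt K) n
      ≤ 6 * K * (1 + 2 * K) / q := by
  rcases K.eq_zero_or_pos with rfl | hK
  · simp [smoothMangoldt, poissonWeight, indicator]
  have hε : (0 : ℝ) < (2 * K : ℝ)⁻¹ := by positivity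
  have hinj : Function.Injective fun k : ℕ => r + (k + 1) * q := fun i j h => by
    simpa [show q ≠ 0 by lia] using h
  have hsum : Summable fun k : ℕ => ((k + 1 : ℕ) : ℝ) ^ (-(1 + (2 * K : ℝ)⁻¹)) :=
    (summable_nat_add_iff 1).2 (summable_nat_rpow.2 (by linarith))
  rw [← hinj.tsum_eq (support_indicator_subset.trans (modEq_diff_singleton_subset_range hr))]
  calc ∑' k : ℕ, ({n | n ≡ r [MOD q]} \ {r}).indicator (smoothMangoldt K) (r + (k + 1) * q)
      ≤ ∑' k : ℕ, 6 * K / q * ((k + 1 : ℕ) : ℝ) ^ (-(1 + (2 * K : ℝ)⁻¹)) :=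
        (((summable_smoothMangoldt K).indicator _).comp_injective hinj).tsum_le_tsum
          (fun k => (indicator_le_self' (fun n _ => smoothMangoldt_nonneg K n) _).trans
            (smoothMangoldt_add_mul_le (by lia) r k)) (hsum.mul_left _)
    _ = 6 * K / q * ∑' k : ℕ, ((k + 1 : ℕ) : ℝ) ^ (-(1 + (2 * K : ℝ)⁻¹)) := tsum_mul_left
    _ ≤ 6 * K / q * (1 + 2 * K) := by
        refine mul_le_mul_of_nonneg_left ?_ (by positivity)
        simpa only [inv_inv] using tsum_rpow_neg_one_add_le hε
    _ = 6 * K * (1 + 2 * K) / q := by ring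

theorem abs_tsum_indicator_smoothMangoldt_modEq_sub_le {q r : ℕ} (hr₀ : 0 < r) (hr : r < q)
    (hK : ((2 : ℝ) ^ K)⁻¹ ≤ (q : ℝ)⁻¹) :
    |∑' n, {n | n ≡ r [MOD q]}.indicator (smoothMangoldt K) n - vonMangoldt r / r|
      ≤ (Real.log q + 6 * K * (1 + 2 * K)) / q := by
  refine (abs_tsum_indicator_smoothMangoldt_sub_le (s := {n | n ≡ r [MOD q]})
    (Nat.ModEq.refl r)).trans ?_
  rw [add_div, div_eq_inv_mul (Real.log q)]
  have hlog : vonMangoldt r ≤ Real.log q := vonMangoldt_le_log.trans (by gcongr)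
  exact add_le_add (mul_le_mul hK hlog vonMangoldt_nonneg (by positivity))
    (tsum_indicator_smoothMangoldt_modEq_diff_le hr)

end ArithmeticProgressions

section PrimePowersInClass

open ArithmeticFunction Set

/-- The powers `p ^ e` with `e ≥ 1` that are congruent to `c` modulo `m`. With `m = q / p ^ ν` and
`c = r⁻¹`, the least one is `p ^ e(q; p, r)`. -/
def primePowersInClass (p m c : ℕ) : Set ℕ :=
  {n | ∃ e : ℕ, 1 ≤ e ∧ n = p ^ e ∧ n ≡ c [MOD m]}

variable {p m c n₀ n q K : ℕ}

theorem vonMangoldt_of_mem_primePowersInClass (hp : p.Prime) (hn : n ∈ primePowersInClass p m c) :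
    vonMangoldt n = Real.log p := by
  obtain ⟨e, he, rfl, -⟩ := hn
  rw [vonMangoldt_apply_pow (Nat.one_le_iff_ne_zero.1 he), vonMangoldt_apply_prime hp]

theorem le_of_modEq_one (hn : 1 < n) (h : n ≡ 1 [MOD m]) : m ≤ n :=
  (Nat.le_of_dvd (Nat.sub_pos_of_lt hn) ((Nat.modEq_iff_dvd' hn.le).1 h.symm)).trans
    (Nat.sub_le n 1)

theorem mul_le_of_mem_primePowersInClass (hp : p.Prime) (hpm : p.Coprime m)
    (hn₀ : n₀ ∈ primePowersInClass p m c) (hn : n ∈ primePowersInClass p m c) (hlt : n₀ < n) :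
    m * p ≤ n := by
  obtain ⟨e₀, he₀, rfl, hc₀⟩ := hn₀
  obtain ⟨e, -, rfl, hc⟩ := hn
  obtain ⟨i, rfl⟩ := Nat.exists_eq_add_of_lt ((Nat.pow_lt_pow_iff_right hp.one_lt).1 hlt)
  have hone : p ^ (i + 1) ≡ 1 [MOD m] := by
    refine Nat.ModEq.cancel_left_of_coprime (c := p ^ e₀) (hpm.symm.pow_right e₀) ?_
    rw [mul_one, ← pow_add]
    exact hc.trans hc₀.symm
  calc m * p ≤ p ^ (i + 1) * p ^ e₀ := Nat.mul_le_mul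
        (le_of_modEq_one (Nat.one_lt_pow i.succ_ne_zero hp.one_lt) hone)
        (Nat.le_self_pow (by lia) p)
    _ = p ^ (e₀ + i + 1) := by ring

theorem tsum_ite_inv_pow_le {x X : ℝ} (hx : 2 ≤ x) (hX : 0 < X) :
    ∑' k : ℕ, (if X ≤ x ^ k then (x ^ k)⁻¹ else 0) ≤ 2 * X⁻¹ := by
  classical
  have hex : ∃ k : ℕ, X ≤ x ^ k := (pow_unbounded_of_one_lt X (by linarith)).imp fun _ => le_of_lt
  set k₀ := Nat.find hex
  have hinj : Function.Injective fun k : ℕ => k₀ + k := add_right_injective k₀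
  have hsupport : Function.support (fun k : ℕ => if X ≤ x ^ k then (x ^ k)⁻¹ else 0)
      ⊆ range fun k : ℕ => k₀ + k := fun k hk =>
    ⟨k - k₀, Nat.add_sub_of_le (Nat.find_min' hex (by_contra fun h => hk (if_neg h)))⟩
  have hif (k : ℕ) : X ≤ x ^ (k₀ + k) :=
    (Nat.find_spec hex).trans (pow_le_pow_right₀ (by linarith) (Nat.le_add_right _ _))
  have hgeom : (1 - x⁻¹)⁻¹ ≤ 2 := by
    have : x⁻¹ ≤ 2⁻¹ := by gcongr
    rw [inv_le_comm₀ (by linarith) two_pos]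
    linarith
  rw [← hinj.tsum_eq hsupport]
  simp_rw [if_pos (hif _), pow_add, mul_inv, ← inv_pow x]
  rw [tsum_mul_left, tsum_geometric_of_lt_one (by positivity) (inv_lt_one_of_one_lt₀ (by linarith)),
    mul_comm, inv_pow]
  gcongr
  exact Nat.find_spec hex

theorem tsum_indicator_smoothMangoldt_primePowersInClass_diff_le (hp : p.Prime) (hm : 0 < m)
    (hpm : p.Coprime m) (hn₀ : IsLeast (primePowersInClass p m c) n₀) :
    ∑' n, (primePowersInClass p m c \ {n₀}).indicator (smoothMangoldt K) n
      ≤ 2 * Real.log p / (m * p) := by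
  have hinj : Function.Injective fun k : ℕ => p ^ k := Nat.pow_right_injective hp.two_le
  have hsupport : Function.support
      ((primePowersInClass p m c \ {n₀}).indicator (smoothMangoldt K)) ⊆ range fun k => p ^ k :=
    support_indicator_subset.trans fun _ ⟨⟨e, _, he, _⟩, _⟩ => ⟨e, he.symm⟩
  have hlog : 0 ≤ Real.log p := Real.log_natCast_nonneg p
  have hmp : (0 : ℝ) < m * p := by exact_mod_cast Nat.mul_pos hm hp.pos
  have hp₂ : (2 : ℝ) ≤ p := Nat.ofNat_le_cast.2 hp.two_le
  have hterm (k : ℕ) : (primePowersInClass p m c \ {n₀}).indicator (smoothMangoldt K) (p ^ k)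
      ≤ Real.log p * if (m * p : ℝ) ≤ (p : ℝ) ^ k then ((p : ℝ) ^ k)⁻¹ else 0 := by
    by_cases hk : p ^ k ∈ primePowersInClass p m c \ {n₀}
    · have hle : (m * p : ℝ) ≤ (p : ℝ) ^ k := by
        exact_mod_cast mul_le_of_mem_primePowersInClass hp hpm hn₀.1 hk.1
          ((hn₀.2 hk.1).lt_of_ne' hk.2)
      rw [indicator_of_mem hk, if_pos hle, ← div_eq_mul_inv,
        ← vonMangoldt_of_mem_primePowersInClass hp hk.1, ← Nat.cast_pow]
      exact smoothMangoldt_le K _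
    · rw [indicator_of_notMem hk]
      positivity
  have hsum : Summable fun k : ℕ => if (m * p : ℝ) ≤ (p : ℝ) ^ k then ((p : ℝ) ^ k)⁻¹ else 0 := by
    refine .of_nonneg_of_le (fun k => by positivity) (fun k => ?_)
      (summable_geometric_of_lt_one (r := (p : ℝ)⁻¹) (by positivity)
        (inv_lt_one_of_one_lt₀ (by linarith)))
    rw [inv_pow]
    split_ifs
    · rfl
    · positivity
  rw [← hinj.tsum_eq hsupport]
  calc _ ≤ ∑' k, Real.log p * if (m * p : ℝ) ≤ (p : ℝ) ^ k then ((p : ℝ) ^ k)⁻¹ else 0 :=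
        (((summable_smoothMangoldt K).indicator _).comp_injective hinj).tsum_le_tsum hterm
          (hsum.mul_left _)
    _ ≤ Real.log p * (2 * (m * p : ℝ)⁻¹) := by
        rw [tsum_mul_left]
        exact mul_le_mul_of_nonneg_left (tsum_ite_inv_pow_le hp₂ hmp) hlog
    _ = 2 * Real.log p / (m * p) := by ring

theorem abs_tsum_indicator_smoothMangoldt_primePowersInClass_sub_le (hp : p.Prime) (hm : 0 < m)
    (hpm : p.Coprime m) (hn₀ : IsLeast (primePowersInClass p m c) n₀) :
    |∑' n, (primePowersInClass p m c).indicator (smoothMangoldt K) n - Real.log p / n₀|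
      ≤ (2 ^ K)⁻¹ * Real.log p + 2 * Real.log p / (m * p) := by
  rw [← vonMangoldt_of_mem_primePowersInClass hp hn₀.1]
  refine (abs_tsum_indicator_smoothMangoldt_sub_le hn₀.1).trans (add_le_add_right ?_ _)
  rw [vonMangoldt_of_mem_primePowersInClass hp hn₀.1]
  exact tsum_indicator_smoothMangoldt_primePowersInClass_diff_le hp hm hpm hn₀

theorem hTerm_eq_zero {r : (ZMod q)ˣ}
    (h : primePowersInClass p (ordCompl[p] q) ((r⁻¹ : (ZMod q)ˣ) : ZMod q).val = ∅) :
    hTerm q p r = 0 := by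
  refine if_pos (sInf_eq_top.2 ?_)
  rintro _ ⟨e, rfl, he, hc⟩
  exact (eq_empty_iff_forall_notMem.1 h (p ^ e) ⟨e, he, rfl, hc⟩).elim

theorem hTerm_eq_of_isLeast (hp : p.Prime) {r : (ZMod q)ˣ}
    (h : IsLeast (primePowersInClass p (ordCompl[p] q) ((r⁻¹ : (ZMod q)ˣ) : ZMod q).val) n₀) :
    hTerm q p r = ((ordProj[p] q).totient : ℝ)⁻¹ * (Real.log p / n₀) := by
  obtain ⟨⟨e, he, rfl, hc⟩, hmin⟩ := h
  have heExp : eExp q p r = e := by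
    refine le_antisymm (sInf_le ⟨e, rfl, he, hc⟩) (le_sInf ?_)
    rintro _ ⟨i, rfl, hi, hci⟩
    exact Nat.cast_le.2 ((Nat.pow_le_pow_iff_right hp.one_lt).1 (hmin ⟨i, hi, rfl, hci⟩))
  rw [hTerm, heExp, if_neg (ENat.natCast_ne_top e), ENat.toNat_natCast, one_div, Nat.cast_pow]

theorem pow_le_two_mul_totient_pow (hp : p.Prime) (k : ℕ) : p ^ k ≤ 2 * (p ^ k).totient := by
  rcases k with _ | k
  · simp
  have := hp.two_le
  rw [Nat.totient_prime_pow_succ hp, pow_succ, mul_left_comm]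
  gcongr
  lia

theorem le_two_mul_totient_ordProj_mul_ordCompl (hp : p.Prime) (q : ℕ) :
    q ≤ 2 * ((ordProj[p] q).totient * ordCompl[p] q) := by
  rw [← mul_assoc]
  exact (Nat.ordProj_mul_ordCompl_eq_self q p).ge.trans
    (Nat.mul_le_mul_right _ (pow_le_two_mul_totient_pow hp _))

theorem abs_inv_totient_mul_tsum_primePowersInClass_sub_hTerm_le [NeZero q] (hp : p.Prime)
    (hK : ((2 : ℝ) ^ K)⁻¹ ≤ (q : ℝ)⁻¹) (u : (ZMod q)ˣ) :
    |((ordProj[p] q).totient : ℝ)⁻¹ * ∑' n,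
        (primePowersInClass p (ordCompl[p] q) (u : ZMod q).val).indicator (smoothMangoldt K) n
      - hTerm q p u⁻¹| ≤ 3 * Real.log p / q := by
  have hle : (q : ℝ) ≤ 2 * ((ordProj[p] q).totient * (ordCompl[p] q : ℕ)) := by
    exact_mod_cast le_two_mul_totient_ordProj_mul_ordCompl hp q
  set m := ordCompl[p] q
  set φ : ℝ := ((ordProj[p] q).totient : ℝ)
  have : 0 ≤ Real.log p := Real.log_natCast_nonneg p
  rcases (primePowersInClass p m (u : ZMod q).val).eq_empty_or_nonempty with hA | hA
  · rw [hTerm_eq_zero (by rwa [inv_inv]), hA]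
    simp only [indicator_empty, tsum_zero, mul_zero, sub_zero, abs_zero]
    positivity
  have hm : 0 < m := Nat.ordCompl_pos p (NeZero.ne q)
  have hφ : 1 ≤ φ := Nat.one_le_cast.2 (Nat.totient_pos.2 (Nat.ordProj_pos q p))
  have hq : (q : ℝ) ≤ φ * (m * p) := by
    have hp₂ : (2 : ℝ) ≤ p := Nat.ofNat_le_cast.2 hp.two_le
    calc (q : ℝ) ≤ 2 * (φ * m) := hle
      _ ≤ p * (φ * m) := by gcongr
      _ = φ * (m * p) := by ring
  have hq₀ : (0 : ℝ) < q := Nat.cast_pos.2 (NeZero.pos q)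
  have hleast := isLeast_csInf hA
  rw [hTerm_eq_of_isLeast hp (by rwa [inv_inv]), ← mul_sub, abs_mul, abs_of_nonneg (by positivity)]
  calc _ ≤ φ⁻¹ * ((2 ^ K)⁻¹ * Real.log p + 2 * Real.log p / (m * p)) := by
        gcongr
        exact abs_tsum_indicator_smoothMangoldt_primePowersInClass_sub_le hp hm
          (Nat.coprime_ordCompl hp (NeZero.ne q)) hleast
    _ = φ⁻¹ * ((2 ^ K)⁻¹ * Real.log p) + 2 * Real.log p / (φ * (m * p)) := by field_simp
    _ ≤ 1 * ((q : ℝ)⁻¹ * Real.log p) + 2 * Real.log p / q := by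
        gcongr
        exact inv_le_one_of_one_le₀ hφ
    _ = 3 * Real.log p / q := by ring

theorem hTerm_one_le (hq : 1 < q) (hp : p.Prime) : hTerm q p 1 ≤ 2 * Real.log p / q := by
  have : 0 ≤ Real.log p := Real.log_natCast_nonneg p
  have := NeZero.of_gt hq
  have : Fact (1 < q) := ⟨hq⟩
  set A := primePowersInClass p (ordCompl[p] q) (((1⁻¹ : (ZMod q)ˣ) : ZMod q)).val
  rcases A.eq_empty_or_nonempty with hA₀ | hA₀
  · rw [hTerm_eq_zero hA₀]
    positivity
  have hleast : IsLeast A (sInf A) := isLeast_csInf hA₀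
  obtain ⟨e, he, hn, hc⟩ := hleast.1
  rw [inv_one, Units.val_one, ZMod.val_one] at hc
  have hle := le_of_modEq_one (hn ▸ Nat.one_lt_pow (by lia) hp.one_lt) hc
  have hφ : (0 : ℝ) < (ordProj[p] q).totient :=
    Nat.cast_pos.2 (Nat.totient_pos.2 (Nat.ordProj_pos q p))
  have hq₂ : (q : ℝ) ≤ 2 * ((ordProj[p] q).totient * (sInf A : ℕ)) := by
    exact_mod_cast (le_two_mul_totient_ordProj_mul_ordCompl hp q).trans (by gcongr)
  rw [hTerm_eq_of_isLeast hp hleast]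
  calc _ = 2 * Real.log p / (2 * ((ordProj[p] q).totient * (sInf A : ℕ))) := by
        field_simp
    _ ≤ 2 * Real.log p / q := by gcongr

end PrimePowersInClass

section CharacterSums

open ArithmeticFunction Set

variable {q : ℕ}

theorem apply_inv_of_unit (χ : DirichletCharacter ℂ q) (u : (ZMod q)ˣ) :
    χ ((u⁻¹ : (ZMod q)ˣ) : ZMod q) = starRingEnd ℂ (χ (u : ZMod q)) := by
  rw [starRingEnd_apply, MulChar.star_apply', MulChar.inv_apply, Ring.inverse_unit]

theorem sum_inv_mul_primitiveCharacter [NeZero q] {m n : ℕ} (hm : m ∣ q) (hn : n.Coprime m)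
    (hmax : ∀ d, d ∣ q → n.Coprime d → d ∣ m) (u : (ZMod q)ˣ) :
    ∑ χ : DirichletCharacter ℂ q, χ ((u⁻¹ : (ZMod q)ˣ) : ZMod q) * χ.primitiveCharacter n
      = if n ≡ (u : ZMod q).val [MOD m] then (m.totient : ℂ) else 0 := by
  have : NeZero m := ⟨ne_zero_of_dvd_ne_zero (NeZero.ne q) hm⟩
  have hlevel : ∑ ψ : DirichletCharacter ℂ m,
        ψ (ZMod.castHom hm (ZMod m) u)⁻¹ * ψ (n : ZMod m)
      = ∑ χ : DirichletCharacter ℂ q,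
        χ ((u⁻¹ : (ZMod q)ˣ) : ZMod q) * χ.primitiveCharacter n := by
    refine Finset.sum_of_injOn (DirichletCharacter.changeLevel hm)
      (DirichletCharacter.changeLevel_injective hm).injOn (by simp) (fun χ _ hχ => ?_)
      fun ψ _ => ?_
    · by_contra hne
      have hcop : n.Coprime χ.conductor := (ZMod.isUnit_iff_coprime _ _).1 <|
        by_contra fun h => right_ne_zero_of_mul hne (MulChar.map_nonunit _ h)
      obtain ⟨_, ψ, hψ⟩ := (χ.mem_conductorSet_iff_conductor_dvd hm).2
        (hmax _ χ.conductor_dvd_level hcop)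
      exact hχ ⟨ψ, Finset.mem_coe.2 (Finset.mem_univ _), hψ.symm⟩
    · have hinv : (ZMod.castHom hm (ZMod m) u)⁻¹
          = ZMod.castHom hm (ZMod m) ((u⁻¹ : (ZMod q)ˣ) : ZMod q) :=
        ZMod.inv_eq_of_mul_eq_one _ _ _ (by rw [← map_mul, Units.mul_inv, map_one])
      have hprim : (DirichletCharacter.changeLevel hm ψ).primitiveCharacter n = ψ n := by
        have h := DirichletCharacter.primitiveCharacter_changeLevel_apply hm ψ n
        rw [ψ.primitiveCharacter_apply_of_isCoprime (Nat.isCoprime_iff_coprime.2 hn)] at h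
        simpa only [Int.cast_natCast] using h
      rw [hprim, DirichletCharacter.changeLevel_eq_cast_of_dvd, hinv, ZMod.castHom_apply]
  rw [← hlevel, DirichletCharacter.sum_char_inv_mul_char_eq ℂ (u.isUnit.map _),
    ZMod.castHom_apply, ZMod.cast_eq_val]
  simp only [← ZMod.natCast_eq_natCast_iff, eq_comm]

theorem sum_inv_mul_primitiveCharacter_prime_pow [NeZero q] {p k : ℕ} (hp : p.Prime) (hk : k ≠ 0)
    (u : (ZMod q)ˣ) :
    ∑ χ : DirichletCharacter ℂ q,
        χ ((u⁻¹ : (ZMod q)ˣ) : ZMod q) * χ.primitiveCharacter (p ^ k : ℕ)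
      = if p ^ k ≡ (u : ZMod q).val [MOD ordCompl[p] q] then ((ordCompl[p] q).totient : ℂ) else 0 :=
  sum_inv_mul_primitiveCharacter (Nat.ordCompl_dvd q p)
    ((Nat.coprime_ordCompl hp (NeZero.ne q)).pow_left k)
    (fun _ hd hcop => Nat.dvd_ordCompl_of_dvd_not_dvd hd (hp.coprime_iff_not_dvd.1
      ((Nat.coprime_pow_left_iff (Nat.pos_of_ne_zero hk) _ _).1 hcop))) u

theorem pow_mem_primePowersInClass_iff {p l m c k : ℕ} (hp : p.Prime) (hl : l.Prime) (hk : k ≠ 0) :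
    p ^ k ∈ primePowersInClass l m c ↔ p = l ∧ p ^ k ≡ c [MOD m] := by
  constructor
  · rintro ⟨e, he, h, hc⟩
    exact ⟨(Nat.Prime.pow_inj' hp hl hk (by lia) h).1, hc⟩
  · rintro ⟨rfl, hc⟩
    exact ⟨k, Nat.one_le_iff_ne_zero.2 hk, rfl, hc⟩

/-- The coefficient of `φ(q)` in `∑ χ(u)⁻¹ χ*(n) smoothMangoldt K n`, summed over all characters
`χ` modulo `q`: besides the class of `u` modulo `q` it sees, for every prime `p ∣ q`, the powers
of `p` in the class of `u` modulo the largest divisor of `q` prime to `p`. -/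
noncomputable def classSummand (K : ℕ) (u : (ZMod q)ˣ) (n : ℕ) : ℝ :=
  {n | n ≡ (u : ZMod q).val [MOD q]}.indicator (smoothMangoldt K) n +
    ∑ p ∈ q.primeFactors, ((ordProj[p] q).totient : ℝ)⁻¹ *
      (primePowersInClass p (ordCompl[p] q) (u : ZMod q).val).indicator (smoothMangoldt K) n

theorem classSummand_prime_pow_of_dvd [NeZero q] (K : ℕ) (u : (ZMod q)ˣ) {p k : ℕ} (hp : p.Prime)
    (hk : k ≠ 0) (hpq : p ∣ q) :
    classSummand K u (p ^ k) = ((ordProj[p] q).totient : ℝ)⁻¹ *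
      if p ^ k ≡ (u : ZMod q).val [MOD ordCompl[p] q] then smoothMangoldt K (p ^ k) else 0 := by
  have hclass : p ^ k ∉ {n | n ≡ (u : ZMod q).val [MOD q]} := fun h =>
    hp.coprime_iff_not_dvd.1 ((Nat.coprime_pow_left_iff (Nat.pos_of_ne_zero hk) _ _).1
      ((show p ^ k ≡ _ [MOD q] from h).gcd_eq.trans (ZMod.val_coe_unit_coprime u))) hpq
  rw [classSummand, indicator_of_notMem hclass, zero_add,
    Finset.sum_eq_single_of_mem p (Nat.mem_primeFactors.2 ⟨hp, hpq, NeZero.ne q⟩)]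
  · simp only [indicator, pow_mem_primePowersInClass_iff hp hp hk, true_and]
  · intro l hl hne
    rw [indicator_of_notMem, mul_zero]
    exact fun h => hne.symm
      ((pow_mem_primePowersInClass_iff hp (Nat.prime_of_mem_primeFactors hl) hk).1 h).1

theorem classSummand_prime_pow_of_not_dvd (K : ℕ) (u : (ZMod q)ˣ) {p k : ℕ} (hp : p.Prime)
    (hk : k ≠ 0) (hpq : ¬p ∣ q) :
    classSummand K u (p ^ k)
      = if p ^ k ≡ (u : ZMod q).val [MOD q] then smoothMangoldt K (p ^ k) else 0 := by
  rw [classSummand, Finset.sum_eq_zero fun l hl => ?_, add_zero]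
  · simp only [indicator, mem_ofPred_eq]
    congr
  rw [indicator_of_notMem, mul_zero]
  intro h
  obtain rfl := ((pow_mem_primePowersInClass_iff hp (Nat.prime_of_mem_primeFactors hl) hk).1 h).1
  exact hpq (Nat.dvd_of_mem_primeFactors hl)

theorem sum_inv_mul_primitiveCharacter_mul_smoothMangoldt [NeZero q] (K : ℕ) (u : (ZMod q)ˣ)
    (n : ℕ) :
    ∑ χ : DirichletCharacter ℂ q,
        χ ((u⁻¹ : (ZMod q)ˣ) : ZMod q) * (χ.primitiveCharacter n * (smoothMangoldt K n : ℂ))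
      = q.totient * classSummand K u n := by
  simp_rw [← mul_assoc]
  rw [← Finset.sum_mul]
  by_cases hn : IsPrimePow n
  · obtain ⟨p, k, hp, hk, rfl⟩ := (isPrimePow_nat_iff n).1 hn
    rw [sum_inv_mul_primitiveCharacter_prime_pow hp hk.ne']
    by_cases hpq : p ∣ q
    · have htot : q.totient = (ordProj[p] q).totient * (ordCompl[p] q).totient := by
        rw [← Nat.totient_mul ((Nat.coprime_ordCompl hp (NeZero.ne q)).pow_left _),
          Nat.ordProj_mul_ordCompl_eq_self]
      have hφ : ((ordProj[p] q).totient : ℂ) ≠ 0 :=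
        Nat.cast_ne_zero.2 (Nat.totient_pos.2 (Nat.ordProj_pos q p)).ne'
      rw [classSummand_prime_pow_of_dvd K u hp hk.ne' hpq, htot]
      split_ifs
      · push_cast
        field_simp
      · simp
    · rw [classSummand_prime_pow_of_not_dvd K u hp hk.ne' hpq,
        (Nat.ordCompl_eq_self_iff_zero_or_not_dvd q hp).2 (.inr hpq)]
      split_ifs <;> simp
  · have hΛ : smoothMangoldt K n = 0 := by
      rw [smoothMangoldt, vonMangoldt_eq_zero_iff.2 hn, zero_div, zero_mul]
    simp [classSummand, indicator, hΛ]

theorem tsum_classSummand (K : ℕ) (u : (ZMod q)ˣ) :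
    ∑' n, classSummand K u n
      = ∑' n, {n | n ≡ (u : ZMod q).val [MOD q]}.indicator (smoothMangoldt K) n
        + ∑ p ∈ q.primeFactors, ((ordProj[p] q).totient : ℝ)⁻¹ * ∑' n,
          (primePowersInClass p (ordCompl[p] q) (u : ZMod q).val).indicator
            (smoothMangoldt K) n := by
  have hs (s : Set ℕ) := (summable_smoothMangoldt K).indicator s
  simp_rw [← tsum_mul_left]
  rw [← Summable.tsum_finsetSum fun p _ => (hs _).mul_left _,
    ← (hs _).tsum_add (summable_sum fun p _ => (hs _).mul_left _)]
  rfl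

theorem norm_sq_sub_dirichletCharacter (χ : DirichletCharacter ℂ q) (a b : (ZMod q)ˣ) :
    ((‖χ (a : ZMod q) - χ (b : ZMod q)‖ ^ 2 : ℝ) : ℂ)
      = 2 * χ ((1⁻¹ : (ZMod q)ˣ) : ZMod q) - χ (((a * b⁻¹)⁻¹ : (ZMod q)ˣ) : ZMod q)
        - χ (((b * a⁻¹)⁻¹ : (ZMod q)ˣ) : ZMod q) := by
  have hnorm (u : (ZMod q)ˣ) : χ u * χ ((u⁻¹ : (ZMod q)ˣ) : ZMod q) = 1 := by
    rw [← map_mul, Units.mul_inv, map_one]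
  have hsq := Complex.mul_conj' (χ (a : ZMod q) - χ (b : ZMod q))
  rw [map_sub, ← apply_inv_of_unit, ← apply_inv_of_unit] at hsq
  push_cast
  rw [← hsq]
  simp only [mul_inv, inv_inv, inv_one, Units.val_one, map_one, Units.val_mul, map_mul]
  linear_combination hnorm a + hnorm b

theorem norm_sq_sub_dirichletCharacter_le (χ : DirichletCharacter ℂ q) (x y : ZMod q) :
    ‖χ x - χ y‖ ^ 2 ≤ 4 := by
  have h : ‖χ x - χ y‖ ≤ 2 :=
    (norm_sub_le_of_le (χ.norm_le_one x) (χ.norm_le_one y)).trans_eq one_add_one_eq_two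
  calc ‖χ x - χ y‖ ^ 2 ≤ 2 ^ 2 := by gcongr
    _ = 4 := by norm_num

theorem sum_norm_sq_sub_mul_tsum [NeZero q] (K : ℕ) (a b : (ZMod q)ˣ) :
    ∑ χ : DirichletCharacter ℂ q, ((‖χ (a : ZMod q) - χ (b : ZMod q)‖ ^ 2 : ℝ) : ℂ) *
        ∑' n : ℕ, χ.primitiveCharacter n * (smoothMangoldt K n : ℂ)
      = ((q.totient * (2 * ∑' n, classSummand K (1 : (ZMod q)ˣ) n
        - ∑' n, classSummand K (a * b⁻¹) n - ∑' n, classSummand K (b * a⁻¹) n) : ℝ) : ℂ) := by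
  have hclass (u : (ZMod q)ˣ) : ∑ χ : DirichletCharacter ℂ q,
      χ ((u⁻¹ : (ZMod q)ˣ) : ZMod q) *
        ∑' n : ℕ, χ.primitiveCharacter n * (smoothMangoldt K n : ℂ)
      = q.totient * ((∑' n, classSummand K u n : ℝ) : ℂ) := by
    simp_rw [Complex.ofReal_tsum, ← tsum_mul_left,
      ← sum_inv_mul_primitiveCharacter_mul_smoothMangoldt]
    exact (Summable.tsum_finsetSum fun χ _ =>
      (summable_mul_smoothMangoldt χ.primitiveCharacter K).mul_left _).symm
  simp_rw [norm_sq_sub_dirichletCharacter, sub_mul, Finset.sum_sub_distrib, mul_assoc,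
    ← Finset.mul_sum, hclass]
  push_cast
  ring

end CharacterSums

section MainTerm

open ArithmeticFunction

variable {q : ℕ}

theorem val_coe_unit_pos (hq : 1 < q) (u : (ZMod q)ˣ) : 0 < (u : ZMod q).val := by
  refine Nat.pos_of_ne_zero fun h => hq.ne' ?_
  simpa only [h, Nat.coprime_zero_left] using ZMod.val_coe_unit_coprime u

theorem leastPosResidue_coe_unit (hq : 1 < q) (u : (ZMod q)ˣ) :
    leastPosResidue (u : ZMod q) = (u : ZMod q).val := by
  have : NeZero q := ⟨by lia⟩
  refine IsLeast.csInf_eq ⟨⟨val_coe_unit_pos hq u, ZMod.natCast_zmod_val _⟩, ?_⟩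
  rintro r ⟨-, hr⟩
  rw [← hr, ZMod.val_natCast]
  exact Nat.mod_le r q

theorem sum_log_primeFactors_le (hq : q ≠ 0) :
    ∑ p ∈ q.primeFactors, Real.log p ≤ Real.log q := by
  have hpos {p : ℕ} (hp : p ∈ q.primeFactors) : 0 < p := (Nat.prime_of_mem_primeFactors hp).pos
  rw [← Real.log_prod fun p hp => Nat.cast_ne_zero.2 (hpos hp).ne', ← Nat.cast_prod]
  exact Real.log_le_log (Nat.cast_pos.2 (Finset.prod_pos fun p => hpos))
    (Nat.cast_le.2 (Nat.le_of_dvd (Nat.pos_of_ne_zero hq) (Nat.prod_primeFactors_dvd q)))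

/-- The main term `Λ(r) / r + ∑ h(q; p, u⁻¹)` contributed by the residue class `u`, where `r` is
the least residue of `u` and `p` runs over the primes dividing `q`. -/
noncomputable def classMain (u : (ZMod q)ˣ) : ℝ :=
  Λ (u : ZMod q).val / (u : ZMod q).val + ∑ p ∈ q.primeFactors, hTerm q p u⁻¹

theorem abs_tsum_classSummand_sub_classMain_le (hq : 1 < q) {K : ℕ}
    (hK : ((2 : ℝ) ^ K)⁻¹ ≤ (q : ℝ)⁻¹) (u : (ZMod q)ˣ) :
    |∑' n, classSummand K u n - classMain u| ≤ (4 * Real.log q + 6 * K * (1 + 2 * K)) / q := by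
  have : NeZero q := ⟨by lia⟩
  have hsum : |∑ p ∈ q.primeFactors, (((ordProj[p] q).totient : ℝ)⁻¹ * ∑' n,
        (primePowersInClass p (ordCompl[p] q) (u : ZMod q).val).indicator (smoothMangoldt K) n
        - hTerm q p u⁻¹)| ≤ 3 * Real.log q / q :=
    calc _ ≤ ∑ p ∈ q.primeFactors, 3 * Real.log p / q :=
          (Finset.abs_sum_le_sum_abs _ _).trans <| Finset.sum_le_sum fun p hp =>
            abs_inv_totient_mul_tsum_primePowersInClass_sub_hTerm_le
              (Nat.prime_of_mem_primeFactors hp) hK u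
      _ = 3 * (∑ p ∈ q.primeFactors, Real.log p) / q := by rw [← Finset.sum_div, ← Finset.mul_sum]
      _ ≤ 3 * Real.log q / q := by
          gcongr
          exact sum_log_primeFactors_le (NeZero.ne q)
  rw [tsum_classSummand, classMain, add_sub_add_comm, ← Finset.sum_sub_distrib]
  calc _ ≤ (Real.log q + 6 * K * (1 + 2 * K)) / q + 3 * Real.log q / q :=
        (abs_add_le _ _).trans (add_le_add (abs_tsum_indicator_smoothMangoldt_modEq_sub_le
          (val_coe_unit_pos hq u) (ZMod.val_lt _) hK) hsum)
    _ = _ := by ring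

theorem hTerm_nonneg (p : ℕ) (u : (ZMod q)ˣ) : 0 ≤ hTerm q p u := by
  rw [hTerm]
  split_ifs
  · exact le_rfl
  · have := Real.log_natCast_nonneg p
    positivity

theorem classMain_nonneg (u : (ZMod q)ˣ) : 0 ≤ classMain u :=
  add_nonneg (div_nonneg vonMangoldt_nonneg (Nat.cast_nonneg _))
    (Finset.sum_nonneg fun p _ => hTerm_nonneg p _)

theorem classMain_one_le (hq : 1 < q) : classMain (1 : (ZMod q)ˣ) ≤ 2 * Real.log q / q := by
  have : Fact (1 < q) := ⟨hq⟩
  rw [classMain, Units.val_one, ZMod.val_one, vonMangoldt_apply_one, zero_div, zero_add, inv_one]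
  calc ∑ p ∈ q.primeFactors, hTerm q p 1 ≤ ∑ p ∈ q.primeFactors, 2 * Real.log p / q :=
        Finset.sum_le_sum fun p hp => hTerm_one_le hq (Nat.prime_of_mem_primeFactors hp)
    _ = 2 * (∑ p ∈ q.primeFactors, Real.log p) / q := by rw [← Finset.sum_div, ← Finset.mul_sum]
    _ ≤ 2 * Real.log q / q := by
        gcongr
        exact sum_log_primeFactors_le (by lia)

theorem classMain_add_classMain (hq : 1 < q) (a b : (ZMod q)ˣ) :
    classMain (a * b⁻¹) + classMain (b * a⁻¹)
      = Λ (leastPosResidue ((a * b⁻¹ : (ZMod q)ˣ) : ZMod q)) /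
          (leastPosResidue ((a * b⁻¹ : (ZMod q)ˣ) : ZMod q) : ℝ)
        + Λ (leastPosResidue ((b * a⁻¹ : (ZMod q)ˣ) : ZMod q)) /
          (leastPosResidue ((b * a⁻¹ : (ZMod q)ˣ) : ZMod q) : ℝ)
        + HSum q a b := by
  rw [classMain, classMain, HSum, Finset.sum_add_distrib, leastPosResidue_coe_unit hq,
    leastPosResidue_coe_unit hq, ← div_eq_mul_inv, ← div_eq_mul_inv, inv_div, inv_div]
  ring

end MainTerm

section Truncation

variable {q : ℕ}

/-- The order `⌈5 log q⌉` at which the Taylor expansion of `L'/L` about `2` is truncated; with it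
`(4/5) ^ truncOrder q ≤ 1 / q`. -/
noncomputable def truncOrder (q : ℕ) : ℕ := ⌈5 * Real.log q⌉₊

theorem inv_pow_truncOrder_le (hq : 0 < q) {x : ℝ} (hx : 5 / 4 ≤ x) :
    (x ^ truncOrder q)⁻¹ ≤ (q : ℝ)⁻¹ := by
  have hx₀ : 0 < x := by linarith
  have hlog : 1 / 5 ≤ Real.log x :=
    calc (1 / 5 : ℝ) = 1 - (5 / 4)⁻¹ := by norm_num
      _ ≤ 1 - x⁻¹ := by gcongr
      _ ≤ Real.log x := Real.one_sub_inv_le_log_of_pos hx₀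
  refine inv_anti₀ (Nat.cast_pos.2 hq) (Real.le_pow_of_log_le hx₀ ?_)
  calc Real.log q = 5 * Real.log q * (1 / 5) := by ring
    _ ≤ truncOrder q * Real.log x := by
        gcongr
        exact Nat.le_ceil _

theorem two_thirds_le_log (hq : 1 < q) : 2 / 3 ≤ Real.log q :=
  calc (2 / 3 : ℝ) ≤ Real.log 2 := by linarith [Real.log_two_gt_d9]
    _ ≤ Real.log q := Real.log_le_log two_pos (Nat.ofNat_le_cast.2 hq)

theorem truncOrder_le (hq : 1 < q) : truncOrder q ≤ 7 * Real.log q := by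
  have hlog := two_thirds_le_log hq
  rw [truncOrder]
  linarith [Nat.ceil_lt_add_one (by positivity : 0 ≤ 5 * Real.log q)]

theorem abs_tsum_classSummand_truncOrder_sub_classMain_le (hq : 1 < q) (u : (ZMod q)ˣ) :
    |∑' n, classSummand (truncOrder q) u n - classMain u| ≤ 680 * (Real.log q ^ 2 / q) := by
  refine (abs_tsum_classSummand_sub_classMain_le hq (inv_pow_truncOrder_le (by lia) (by norm_num))
    u).trans ?_
  rw [← mul_div_assoc]
  gcongr
  have hK := truncOrder_le hq
  have : (0 : ℝ) ≤ truncOrder q := Nat.cast_nonneg _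
  nlinarith [two_thirds_le_log hq]

theorem abs_two_mul_tsum_sub_tsum_sub_tsum_add_classMain_le (hq : 1 < q) (u v : (ZMod q)ˣ) :
    |2 * ∑' n, classSummand (truncOrder q) (1 : (ZMod q)ˣ) n
        - ∑' n, classSummand (truncOrder q) u n - ∑' n, classSummand (truncOrder q) v n
        + (classMain u + classMain v)| ≤ 3000 * (Real.log q ^ 2 / q) := by
  have hone : classMain (1 : (ZMod q)ˣ) ≤ 3 * (Real.log q ^ 2 / q) := by
    rw [← mul_div_assoc]
    refine (classMain_one_le hq).trans (div_le_div_of_nonneg_right ?_ (Nat.cast_nonneg q))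
    nlinarith [two_thirds_le_log hq]
  have herr := fun w : (ZMod q)ˣ =>
    abs_le.1 (abs_tsum_classSummand_truncOrder_sub_classMain_le hq w)
  have hE : 0 ≤ Real.log q ^ 2 / q := by positivity
  rw [abs_le]
  constructor <;>
    linarith [classMain_nonneg (1 : (ZMod q)ˣ), (herr 1).1, (herr 1).2, (herr u).1, (herr u).2,
      (herr v).1, (herr v).2]

end Truncation

section MainTheorem

theorem primitiveCharacter_ne_one {q : ℕ} {χ : DirichletCharacter ℂ q} (hχ : χ ≠ 1) :
    χ.primitiveCharacter ≠ 1 := fun h => hχ <| by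
  rw [← χ.changeLevel_primitiveCharacter, h, map_one]

variable {q : ℕ} [NeZero q]

theorem norm_logDerivLStarOne_add_tsum_le {χ : DirichletCharacter ℂ q} (hχ : χ ≠ 1)
    (hL : haveI : NeZero χ.conductor := ⟨χ.conductor_ne_zero⟩
      ∀ s ∈ Metric.ball (2 : ℂ) (3 / 2), χ.primitiveCharacter.LFunction s ≠ 0) (K : ℕ) :
    ‖logDerivLStarOne χ + ∑' n : ℕ, χ.primitiveCharacter n * (smoothMangoldt K n : ℂ)‖
      ≤ 4400 * Real.log q * (4 / 5) ^ K := by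
  have : NeZero χ.conductor := ⟨χ.conductor_ne_zero⟩
  have hcond : (χ.conductor : ℝ) ≤ q :=
    Nat.cast_le.2 (Nat.le_of_dvd (NeZero.pos q) χ.conductor_dvd_level)
  have hpos : (0 : ℝ) < χ.conductor := Nat.cast_pos.2 (NeZero.pos _)
  refine (norm_logDeriv_LFunction_one_add_tsum_le (primitiveCharacter_ne_one hχ) hL K).trans ?_
  gcongr

theorem norm_Mstar_add_sum_le
    (hL : ∀ χ : DirichletCharacter ℂ q, χ ≠ 1 →
      haveI : NeZero χ.conductor := ⟨χ.conductor_ne_zero⟩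
      ∀ s ∈ Metric.ball (2 : ℂ) (3 / 2), χ.primitiveCharacter.LFunction s ≠ 0)
    (K : ℕ) (a b : (ZMod q)ˣ) :
    ‖Mstar q a b + ∑ χ : DirichletCharacter ℂ q,
        ((‖χ (a : ZMod q) - χ (b : ZMod q)‖ ^ 2 : ℝ) : ℂ) *
        ∑' n : ℕ, χ.primitiveCharacter n * (smoothMangoldt K n : ℂ)‖
      ≤ q.totient * (4 * (4400 * Real.log q * (4 / 5) ^ K)) := by
  classical
  have hcard : (Finset.univ.filter fun χ : DirichletCharacter ℂ q => χ ≠ 1).card ≤ q.totient :=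
    (Finset.card_le_univ _).trans_eq <| by
      rw [← Nat.card_eq_fintype_card,
        DirichletCharacter.card_eq_totient_of_hasEnoughRootsOfUnity]
  have hprincipal (z : ℂ) : ((‖(1 : DirichletCharacter ℂ q) (a : ZMod q)
      - (1 : DirichletCharacter ℂ q) (b : ZMod q)‖ ^ 2 : ℝ) : ℂ) * z = 0 := by
    simp [MulChar.one_apply_coe]
  rw [← Finset.sum_filter_of_ne (p := (· ≠ 1)) fun χ _ h h₁ => h (h₁ ▸ hprincipal _), Mstar,
    ← Finset.sum_add_distrib]
  refine (norm_sum_le _ _).trans ((Finset.sum_le_card_nsmul _ _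
    (4 * (4400 * Real.log q * (4 / 5) ^ K)) fun χ hχ => ?_).trans ?_)
  · rw [← mul_add, norm_mul, Complex.norm_real, Real.norm_of_nonneg (by positivity)]
    have hχ₁ := (Finset.mem_filter.1 hχ).2
    exact mul_le_mul (norm_sq_sub_dirichletCharacter_le χ a b)
      (norm_logDerivLStarOne_add_tsum_le hχ₁ (hL χ hχ₁) K) (norm_nonneg _) (by norm_num)
  · rw [nsmul_eq_mul]
    gcongr

theorem mainTheorem3_general (hq : 1 < q)
    (hL : ∀ χ : DirichletCharacter ℂ q, χ ≠ 1 →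
      haveI : NeZero χ.conductor := ⟨χ.conductor_ne_zero⟩
      ∀ s ∈ Metric.ball (2 : ℂ) (3 / 2), χ.primitiveCharacter.LFunction s ≠ 0)
    (a b : (ZMod q)ˣ) {r₁ r₂ : ℕ}
    (hr₁ : r₁ = leastPosResidue ((a * b⁻¹ : (ZMod q)ˣ) : ZMod q))
    (hr₂ : r₂ = leastPosResidue ((b * a⁻¹ : (ZMod q)ˣ) : ZMod q)) :
    ‖Mstar q a b - (((Nat.totient q : ℝ) *
        (ArithmeticFunction.vonMangoldt r₁ / (r₁ : ℝ) +
          ArithmeticFunction.vonMangoldt r₂ / (r₂ : ℝ) + HSum q a b) : ℝ) : ℂ)‖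
      ≤ 30000 * ((Nat.totient q : ℝ) * (Real.log q ^ 2 / (q : ℝ))) := by
  have htrunc := norm_Mstar_add_sum_le hL (truncOrder q) a b
  rw [sum_norm_sq_sub_mul_tsum] at htrunc
  have hmain := abs_two_mul_tsum_sub_tsum_sub_tsum_add_classMain_le hq (a * b⁻¹) (b * a⁻¹)
  have hpow : Real.log q * (4 / 5) ^ truncOrder q ≤ 3 / 2 * (Real.log q ^ 2 / q) := by
    rw [← inv_div, inv_pow, ← mul_div_assoc, div_eq_mul_inv]
    exact mul_le_mul (by nlinarith [two_thirds_le_log hq]) (inv_pow_truncOrder_le (by lia) le_rfl)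
      (by positivity) (by positivity)
  rw [hr₁, hr₂, ← classMain_add_classMain hq]
  set S := 2 * ∑' n, classSummand (truncOrder q) (1 : (ZMod q)ˣ) n
    - ∑' n, classSummand (truncOrder q) (a * b⁻¹) n
    - ∑' n, classSummand (truncOrder q) (b * a⁻¹) n
  set T := classMain (a * b⁻¹) + classMain (b * a⁻¹)
  calc ‖Mstar q a b - ((q.totient * T : ℝ) : ℂ)‖
      = ‖(Mstar q a b + ((q.totient * S : ℝ) : ℂ)) - ((q.totient * (S + T) : ℝ) : ℂ)‖ := by
        congr 1
        push_cast
        ring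
    _ ≤ q.totient * (4 * (4400 * Real.log q * (4 / 5) ^ truncOrder q))
        + q.totient * (3000 * (Real.log q ^ 2 / q)) := by
        refine norm_sub_le_of_le htrunc ?_
        rw [Complex.norm_real, norm_mul, Real.norm_natCast, Real.norm_eq_abs]
        exact mul_le_mul_of_nonneg_left hmain (Nat.cast_nonneg _)
    _ = q.totient * (17600 * (Real.log q * (4 / 5) ^ truncOrder q)
        + 3000 * (Real.log q ^ 2 / q)) := by ring
    _ ≤ q.totient * (30000 * (Real.log q ^ 2 / q)) := by
        gcongr
        have : 0 ≤ Real.log q ^ 2 / q := by positivity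
        linarith
    _ = _ := by ring

end MainTheorem

theorem mainTheorem3 (hGRH : GRH) :
    ∃ C : ℝ, ∀ (q : ℕ) [NeZero q] (a b : (ZMod q)ˣ), a ≠ b →
      ∀ r₁ r₂ : ℕ,
        r₁ = leastPosResidue ((a * b⁻¹ : (ZMod q)ˣ) : ZMod q) →
        r₂ = leastPosResidue ((b * a⁻¹ : (ZMod q)ˣ) : ZMod q) →
        ‖Mstar q a b - (((Nat.totient q : ℝ) *
            (ArithmeticFunction.vonMangoldt r₁ / (r₁ : ℝ) +
              ArithmeticFunction.vonMangoldt r₂ / (r₂ : ℝ) + HSum q a b) : ℝ) : ℂ)‖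
          ≤ C * ((Nat.totient q : ℝ) * (Real.log q ^ 2 / (q : ℝ))) := by
  refine ⟨30000, fun q _ a b hab r₁ r₂ => mainTheorem3_general ?_ (fun χ hχ _ hs =>
    haveI : NeZero χ.conductor := ⟨χ.conductor_ne_zero⟩
    LFunction_ne_zero_of_mem_ball hGRH (primitiveCharacter_ne_one hχ) hs) a b⟩
  refine Nat.one_lt_iff_ne_zero_and_ne_one.2 ⟨NeZero.ne q, ?_⟩
  rintro rfl
  exact hab (Subsingleton.elim a b)
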